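/- Notation: $|x|$ is the length of the binary representation of $x\in\mathbb N$ (with $|0|=0$), and $|\vec x| = (|x_1|,\dots,|x_k|)$. $\mathbf{FP}$ is the class of functions $\mathbb N^k\to\mathbb N$ ($k\ge 0$) computable in polynomial time on a Turing machine, with numbers written in binary. $\mathbf{FP}/\mathit{poly}$ is the class of functions $f:\mathbb N^k\to\mathbb N$ for which there are words $\alpha_{\vec n}\in\{0,1\}^*$ ($\vec n\in\mathbb N^k$) with $|\alpha_{\vec n}|$ bounded by a polynomial in $\vec n$, and some $f'(x,\vec x)\in\mathbf{FP}$, such that $f(\vec x)=f'(\alpha_{|\vec x|},\vec x)$ for all $\vec x$ (a word $w$ is given to $f'$ as the number with binary representation $1w$). Let $\mathbb R$ be the set of all $r:\mathbb N^k\to\{0,1\}$ ($k\ge 0$) such that $|\vec x|=|\vec y|$ implies $r(\vec x)=r(\vec y)$, and let $\mathrm{nor}\,\mathbb R$ be the set of two-sorted functions $r(\vec x;)$, with normal arguments only, for $r\in\mathbb R$. In a two-sorted function $f(\vec x;\vec y)$ the arguments $\vec x$ are called normal and $\vec y$ safe. For a set $F$ of two-sorted functions, $\mathsf B(F)$ is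 the smallest class of two-sorted functions that contains $F$, the constant $0(;)=0$, $\mathsf s_0(;x)=2x$, $\mathsf s_1(;x)=2x+1$, all projections $(\vec x;\vec y)\mapsto x_j$ and $(\vec x;\vec y)\mapsto y_j$, $\mathsf p(;x)=\lfloor x/2\rfloor$, and $\mathsf{cond}(;w,x,y,z)$ (equal to $x$ if $w=0$, to $y$ if $w\neq 0$ is even, to $z$ if $w$ is odd), and that is closed under * safe composition: from $h(\vec u;\vec v)$, $g_i(\vec x;)$ and $t_j(\vec x;\vec y)$ obtain $h(\vec g(\vec x;);\vec t(\vec x;\vec y))$; * safe recursion on notation: from $g(\vec x;\vec y)$ and $h_i(x,\vec x;\vec y,y)$ ($i=0,1$) obtain the $f$ with $f(0,\vec x;\vec y)=g(\vec x;\vec y)$ and $f(2x+i,\vec x;\vec y)=h_i(x,\vec x;\vec y,f(x,\vec x;\vec y))$ whenever $2x+i\neq 0$. **Proposition.** $\mathbf{FP}/\mathit{poly}\subseteq\mathsf B(\mathrm{nor}\,\mathbb R)$: for every $k$ and every $f:\mathbb N^k\to\mathbb N$ in $\mathbf{FP}/\mathit{poly}$, the two-sorted function $f(\vec x;)$ belongs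 to $\mathsf B(\mathrm{nor}\,\mathbb R)$. -/

import Mathlib

namespace NonUniform

/-- Functions of `k` natural numbers. -/
abbrev Fn (k : ℕ) : Type := (Fin k → ℕ) → ℕ

/-- Two-sorted functions `f(x₁,…,xₘ ; y₁,…,yₙ)` of `m` normal and `n` safe arguments. -/
abbrev Fn₂ (m n : ℕ) : Type := (Fin m → ℕ) → (Fin n → ℕ) → ℕ

/-- The lengths `|x₁|,…,|xₖ|` of the binary representations of the entries of `x`
(with `|0| = 0`). -/
def lengths {k : ℕ} (x : Fin k → ℕ) : Fin k → ℕ := fun i => Nat.size (x i)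

/-! ### Polynomial time and polynomial advice -/

/-- A tuple of natural numbers as a word over the three-letter alphabet `{0, 1, #}`: every entry is
written in binary and is followed by the delimiter `# = none`. -/
def encodeTuple {k : ℕ} (x : Fin k → ℕ) : List (Option Bool) :=
  (List.ofFn x).flatMap fun a => (Computability.encodeNat a).map some ++ [none]

/-- `FP`: the functions on natural numbers (in binary) that some Turing machine computes in
polynomial time. -/
def FP (k : ℕ) : Set (Fn k) :=
  {f | Nonempty (Turing.TM2ComputableInPolyTime encodeTuple Computability.encodeNat f)}

/-- The natural number whose binary representation is `1w`, so that words over `{0, 1}` can be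
arguments of functions on natural numbers. -/
def wordNat (w : List Bool) : ℕ := w.foldl (fun a b => Nat.bit b a) 1

/-- `FP/poly`: the functions `f(x) = f'(α_{|x|}, x)` with `f'` in `FP` and with words `α_n`, indexed
by tuples `n` of lengths, whose size is polynomially bounded in `n`. -/
def FPpoly (k : ℕ) : Set (Fn k) :=
  {f | ∃ (α : (Fin k → ℕ) → List Bool) (p : MvPolynomial (Fin k) ℕ) (f' : Fn (k + 1)),
    (∀ n, (α n).length ≤ MvPolynomial.eval n p) ∧ f' ∈ FP (k + 1) ∧
      ∀ x, f x = f' (Fin.cons (wordNat (α (lengths x))) x)}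

/-! ### The Bellantoni-Cook algebra with oracles -/

/-- The relations (0-1-valued functions) whose value depends only on the lengths of the
arguments. -/
def RR (k : ℕ) : Set (Fn k) :=
  {r | (∀ x, r x = 0 ∨ r x = 1) ∧ ∀ x y, lengths x = lengths y → r x = r y}

/-- The two-sorted functions `f(x;)`, all of whose arguments are normal, for `f` in `F`. -/
def nor (F : ∀ k, Set (Fn k)) (m n : ℕ) : Set (Fn₂ m n) :=
  {f | n = 0 ∧ ∃ g ∈ F m, ∀ x y, f x y = g x}

/-- `B F f`: the two-sorted function `f` belongs to the Bellantoni-Cook algebra with additional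
initial functions `F`. -/
inductive B (F : ∀ m n, Set (Fn₂ m n)) : ∀ {m n : ℕ}, Fn₂ m n → Prop
  | oracle {m n : ℕ} {f : Fn₂ m n} (hf : f ∈ F m n) : B F f
  | zero : B F (fun (_ : Fin 0 → ℕ) (_ : Fin 0 → ℕ) => 0)
  | succ0 : B F (fun (_ : Fin 0 → ℕ) (y : Fin 1 → ℕ) => 2 * y 0)
  | succ1 : B F (fun (_ : Fin 0 → ℕ) (y : Fin 1 → ℕ) => 2 * y 0 + 1)
  | projNormal {m n : ℕ} (j : Fin m) : B F (fun (x : Fin m → ℕ) (_ : Fin n → ℕ) => x j)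
  | projSafe {m n : ℕ} (j : Fin n) : B F (fun (_ : Fin m → ℕ) (y : Fin n → ℕ) => y j)
  | pred : B F (fun (_ : Fin 0 → ℕ) (y : Fin 1 → ℕ) => y 0 / 2)
  | cond : B F (fun (_ : Fin 0 → ℕ) (y : Fin 4 → ℕ) =>
      if y 0 = 0 then y 1 else if y 0 % 2 = 0 then y 2 else y 3)
  /-- Safe composition `h(g₁(x;),…,gₐ(x;) ; t₁(x;y),…,t_b(x;y))`. -/
  | comp {m n a b : ℕ} {h : Fn₂ a b} {g : Fin a → Fn₂ m 0} {t : Fin b → Fn₂ m n}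
      (hh : B F h) (hg : ∀ i, B F (g i)) (ht : ∀ j, B F (t j)) :
      B F (fun x y => h (fun i => g i x Fin.elim0) (fun j => t j x y))
  /-- Safe recursion on notation. -/
  | srec {m n : ℕ} {g : Fn₂ m n} {h0 h1 : Fn₂ (m + 1) (n + 1)} {f : Fn₂ (m + 1) n}
      (hg : B F g) (hh0 : B F h0) (hh1 : B F h1)
      (f_zero : ∀ x y, f (Fin.cons 0 x) y = g x y)
      (f_succ0 : ∀ u x y, u ≠ 0 →
        f (Fin.cons (2 * u) x) y = h0 (Fin.cons u x) (Fin.snoc y (f (Fin.cons u x) y)))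
      (f_succ1 : ∀ u x y,
        f (Fin.cons (2 * u + 1) x) y = h1 (Fin.cons u x) (Fin.snoc y (f (Fin.cons u x) y))) :
      B F f

end NonUniform

/-!
Polynomial time computations with polynomial advice are carried out in the Bellantoni–Cook algebra.

Safe recursion on notation yields recursion along the length of a normal argument (`B.lenRec`).
Functions of safe arguments can inspect and change only boundedly many low bits, but with a normal
argument `w` at hand any bit of a safe value can be looked up at a position below `|w|`, so a value
of length `|w|` can be written bit by bit (`B.append_digits`). Hence tuples of safe values can be
packed into one number with fields of `|w|` bits, and a map of tuples can be iterated as long as all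
values fit into their fields (`BNormal.iterate`). Numbers `w` of sufficient length exist for every
polynomial bound, since lengths can be added and multiplied (`LengthBound`).

A stack machine fits this scheme. A stack is a number made of blocks of bits with its top in the
lowest block, so that pushing, popping and inspecting the top are functions of safe arguments, and
so is a whole step (`exists_totalStep_num`). The stacks grow by a bounded amount in each step, and
the number of steps is polynomially bounded, so the final stacks belong to the algebra
(`exists_bNormal_stack`). Since they are functions of normal arguments, they can in turn be used as
normal arguments, in order to read off the output. This shows that every function in `FP` belongs
to the algebra without the help of oracles (`bNormal_of_mem_FP`).

The advice word for `x` depends on the lengths of `x` only, and so do its length and its bits at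
positions given as lengths of a further argument. These data are therefore oracles, from which
recursion on a sufficiently long number rebuilds the advice (`bNormal_wordNat_advice`).
-/

namespace NonUniform

variable {F : ∀ m n, Set (Fn₂ m n)} {m n : ℕ}

/-! ### Closure properties of the algebra -/

/-- `BNormal F g`: the function `g(x;)`, all of whose arguments are normal, belongs to `B F`. -/
def BNormal (F : ∀ m n, Set (Fn₂ m n)) (g : Fn m) : Prop :=
  B F fun x (_ : Fin 0 → ℕ) => g x

theorem B.comp_normal {a b : ℕ} {h : Fn₂ a b} {g : Fin a → Fn m} {t : Fin b → Fn₂ m n}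
    (hh : B F h) (hg : ∀ i, BNormal F (g i)) (ht : ∀ j, B F (t j)) :
    B F fun x y => h (fun i => g i x) (fun j => t j x y) :=
  B.comp hh hg ht

theorem BNormal.proj (i : Fin m) : BNormal F fun x => x i := B.projNormal i

theorem BNormal.comp {a : ℕ} {h : Fn a} {g : Fin a → Fn m} (hh : BNormal F h)
    (hg : ∀ i, BNormal F (g i)) : BNormal F fun x => h fun i => g i x :=
  B.comp_normal (t := Fin.elim0) hh hg fun j => j.elim0

theorem BNormal.cons {a : ℕ} {h : Fn (a + 1)} {g₀ : Fn m} {g : Fin a → Fn m} (hh : BNormal F h)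
    (hg₀ : BNormal F g₀) (hg : ∀ i, BNormal F (g i)) :
    BNormal F fun x => h (Fin.cons (g₀ x) fun i => g i x) := by
  have := BNormal.comp (g := Fin.cons (α := fun _ => Fn m) g₀ g) hh
    (Fin.cases (by simpa using hg₀) (by simpa using hg))
  convert this using 3 with x
  ext i
  refine Fin.cases ?_ (fun i => ?_) i <;> simp

/-- Functions of normal arguments are functions of normal and safe arguments. -/
theorem BNormal.toB {g : Fn m} (hg : BNormal F g) : B F fun x (_ : Fin n → ℕ) => g x :=
  B.comp_normal (g := fun i x => x i) (t := Fin.elim0) hg (fun i => .proj i) fun j => j.elim0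

/-- Functions without normal arguments can be composed freely in their safe arguments. -/
theorem B.comp_safe {b : ℕ} {h : Fn b} {t : Fin b → Fn₂ m n}
    (hh : B F fun (_ : Fin 0 → ℕ) y => h y) (ht : ∀ j, B F (t j)) :
    B F fun x y => h fun j => t j x y :=
  B.comp_normal (g := Fin.elim0) hh (fun i => i.elim0) ht

theorem B.double {t : Fn₂ m n} (ht : B F t) : B F fun x y => 2 * t x y :=
  B.comp_safe (t := fun _ => t) B.succ0 fun _ => ht

theorem B.double_add_one {t : Fn₂ m n} (ht : B F t) : B F fun x y => 2 * t x y + 1 :=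
  B.comp_safe (t := fun _ => t) B.succ1 fun _ => ht

theorem B.half {t : Fn₂ m n} (ht : B F t) : B F fun x y => t x y / 2 :=
  B.comp_safe (t := fun _ => t) B.pred fun _ => ht

theorem B.cond₃ {t a b c : Fn₂ m n} (ht : B F t) (ha : B F a) (hb : B F b) (hc : B F c) :
    B F fun x y => if t x y = 0 then a x y else if t x y % 2 = 0 then b x y else c x y :=
  B.comp_safe (t := ![t, a, b, c]) B.cond fun j => by fin_cases j <;> assumption

theorem B.ite_even {t a b : Fn₂ m n} (ht : B F t) (ha : B F a) (hb : B F b) :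
    B F fun x y => if t x y % 2 = 0 then a x y else b x y := by
  convert B.cond₃ ht ha ha hb using 3 with x y
  by_cases h : t x y = 0 <;> simp [h]

theorem B.const (c : ℕ) : B F fun (_ : Fin m → ℕ) (_ : Fin n → ℕ) => c := by
  induction c using Nat.strong_induction_on with
  | _ c ih =>
    rcases Nat.eq_zero_or_pos c with rfl | hc
    · exact B.comp_safe (t := Fin.elim0) B.zero fun j => j.elim0
    · have ih' := ih (c / 2) (by lia)
      rcases Nat.mod_two_eq_zero_or_one c with h | h
      · convert ih'.double using 3; lia
      · convert ih'.double_add_one using 3; lia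

theorem BNormal.const (c : ℕ) : BNormal F fun (_ : Fin m → ℕ) => c := B.const c

/-- Definition by cases on the `b` low bits of a safe value. -/
theorem B.cases_mod {t : Fn₂ m n} (ht : B F t) (b : ℕ) {G : ℕ → Fn₂ m n} (hG : ∀ c, B F (G c)) :
    B F fun x y => G (t x y % 2 ^ b) x y := by
  induction b generalizing t G with
  | zero => simpa [Nat.mod_one] using hG 0
  | succ b ih =>
    have h0 := ih ht.half (G := fun c => G (2 * c)) fun c => hG _
    have h1 := ih ht.half (G := fun c => G (2 * c + 1)) fun c => hG _
    convert B.ite_even ht h0 h1 using 3 with x y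
    have e : t x y % 2 ^ (b + 1) = t x y % 2 + 2 * (t x y / 2 % 2 ^ b) := by
      rw [pow_succ', Nat.mod_mul]
    rcases Nat.mod_two_eq_zero_or_one (t x y) with h | h <;> simp [e, h, add_comm]

theorem B.div_two_pow {t : Fn₂ m n} (ht : B F t) (c : ℕ) : B F fun x y => t x y / 2 ^ c := by
  induction c with
  | zero => simpa using ht
  | succ c ih => simpa only [pow_succ, Nat.div_div_eq_div_mul] using ih.half

/-- Appending a block of `c` constant bits. -/
theorem B.mul_two_pow_add {t : Fn₂ m n} (ht : B F t) (c : ℕ) {d : ℕ} (hd : d < 2 ^ c) :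
    B F fun x y => t x y * 2 ^ c + d := by
  induction c generalizing d with
  | zero => obtain rfl : d = 0 := by simpa using hd
            simpa using ht
  | succ c ih =>
    have h := ih (d := d / 2) (by rw [pow_succ] at hd; lia)
    rcases Nat.mod_two_eq_zero_or_one d with e | e
    · convert h.double using 3
      rw [pow_succ]; lia
    · convert h.double_add_one using 3
      rw [pow_succ]; lia

/-! ### Recursion on the length of a normal argument -/

theorem size_two_mul {u : ℕ} (hu : u ≠ 0) : Nat.size (2 * u) = Nat.size u + 1 := by
  simpa [Nat.bit_val] using Nat.size_bit (b := false) (n := u) (by simpa [Nat.bit_val] using hu)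

theorem size_two_mul_add_one (u : ℕ) : Nat.size (2 * u + 1) = Nat.size u + 1 := by
  simpa [Nat.bit_val] using Nat.size_bit (b := true) (n := u) (by simp [Nat.bit_val])

theorem size_div_two_pow (u c : ℕ) : Nat.size (u / 2 ^ c) = Nat.size u - c := by
  refine eq_of_forall_ge_iff fun d => ?_
  rw [Nat.size_le, tsub_le_iff_right, Nat.size_le, Nat.div_lt_iff_lt_mul (by positivity), pow_add]

/-- Safe recursion on notation whose step depends on the recursion argument only through its
length is primitive recursion along that length. -/
theorem B.lenRec {w : Fn m} {G : Fn₂ m n} {H : ℕ → (Fin m → ℕ) → (Fin n → ℕ) → ℕ → ℕ}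
    (hw : BNormal F w) (hG : B F G)
    (hH : B F fun (x : Fin (m + 1) → ℕ) (y : Fin (n + 1) → ℕ) =>
      H (Nat.size (x 0)) (Fin.tail x) (Fin.init y) (y (Fin.last n))) :
    B F fun x y => Nat.rec (motive := fun _ => ℕ) (G x y) (fun j r => H j x y r)
      (Nat.size (w x)) := by
  have key : B F fun (x : Fin (m + 1) → ℕ) (y : Fin n → ℕ) =>
      Nat.rec (motive := fun _ => ℕ) (G (Fin.tail x) y) (fun j r => H j (Fin.tail x) y r)
        (Nat.size (x 0)) :=
    B.srec hG hH hH (by simp) (by intro u x y hu; simp [size_two_mul hu])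
      (by intro u x y; simp [size_two_mul_add_one])
  have := key.comp_normal (g := Fin.cons (α := fun _ => Fn m) w fun i x => x i)
    (t := fun j _ y => y j) (Fin.cases (by simpa using hw) (by simpa using fun i => .proj i))
    (fun j => B.projSafe j)
  exact this

theorem B.weaken {t : Fn₂ m n} (ht : B F t) :
    B F fun (x : Fin (m + 1) → ℕ) (y : Fin (n + 1) → ℕ) => t (Fin.tail x) (Fin.init y) :=
  B.comp_normal (g := fun i x => x i.succ) (t := fun j _ y => y j.castSucc) ht
    (fun i => .proj i.succ) fun j => B.projSafe j.castSucc

theorem BNormal.weaken {g : Fn m} (hg : BNormal F g) :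
    BNormal F fun (x : Fin (m + 1) → ℕ) => g (Fin.tail x) :=
  BNormal.comp hg fun i => .proj i.succ

theorem B.shiftRight {t : Fn₂ m n} (ht : B F t) {w : Fn m} (hw : BNormal F w) (c : ℕ) :
    B F fun x y => t x y / 2 ^ (c * Nat.size (w x)) := by
  convert B.lenRec (H := fun _ _ _ r => r / 2 ^ c) hw ht
    (B.div_two_pow (B.projSafe (Fin.last n)) c) using 3 with x y
  induction Nat.size (w x) with
  | zero => simp
  | succ k ih => simp only [← ih, Nat.div_div_eq_div_mul, ← pow_add, mul_add, mul_one]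

/-- A value can be written, behind the bits of `a`, bit by bit from its high end: it suffices that
the bit with a given index, the length of an additional normal argument, belongs to the algebra. -/
theorem B.append_digits {a v : Fn₂ m n} (ha : B F a) {w : Fn m} (hw : BNormal F w)
    (hv : B F fun (x : Fin (m + 1) → ℕ) y => v (Fin.tail x) y / 2 ^ Nat.size (x 0) % 2) :
    B F fun x y => a x y * 2 ^ Nat.size (w x) + v x y % 2 ^ Nat.size (w x) := by
  -- the bit appended in round `j` has index `|w| - (j + 1)`, the length of `w / 2 ^ (j + 1)`
  let H : ℕ → (Fin m → ℕ) → (Fin n → ℕ) → ℕ → ℕ := fun j x y r =>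
    if v x y / 2 ^ (Nat.size (w x) - (j + 1)) % 2 % 2 = 0 then 2 * r else 2 * r + 1
  have hidx : BNormal F fun (x : Fin (m + 1) → ℕ) =>
      w (Fin.tail x) / 2 ^ (Nat.size (x 0) + 1) := by
    have := (B.shiftRight hw.weaken (BNormal.proj 0) 1).half
    simpa [Nat.div_div_eq_div_mul, ← pow_succ, BNormal] using this
  have hbit : B F fun (x : Fin (m + 1) → ℕ) (y : Fin (n + 1) → ℕ) =>
      v (Fin.tail x) (Fin.init y) / 2 ^ (Nat.size (w (Fin.tail x)) - (Nat.size (x 0) + 1)) % 2 := by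
    have := hv.comp_normal
      (g := Fin.cons (α := fun _ => Fn (m + 1))
        (fun x => w (Fin.tail x) / 2 ^ (Nat.size (x 0) + 1)) fun i x => x i.succ)
      (t := fun (j : Fin n) (_ : Fin (m + 1) → ℕ) (y : Fin (n + 1) → ℕ) => y j.castSucc)
      (Fin.cases (by simpa using hidx) (by simpa using fun i => .proj (Fin.succ i)))
      (fun j => B.projSafe j.castSucc)
    simp only [Fin.cons_zero, size_div_two_pow] at this
    exact this
  have hr : B F fun (_ : Fin (m + 1) → ℕ) (y : Fin (n + 1) → ℕ) => y (Fin.last n) := B.projSafe _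
  convert B.lenRec (H := H) hw ha (B.ite_even hbit hr.double hr.double_add_one) using 3 with x y
  have key : ∀ j ≤ Nat.size (w x), Nat.rec (motive := fun _ => ℕ) (a x y) (fun j r => H j x y r) j =
      a x y * 2 ^ j + v x y / 2 ^ (Nat.size (w x) - j) % 2 ^ j := by
    intro j
    induction j with
    | zero => simp [Nat.mod_one]
    | succ j ih =>
      intro hj
      have e : Nat.size (w x) - j = Nat.size (w x) - (j + 1) + 1 := by lia
      simp only [ih (by lia), H]
      rw [e, pow_succ 2 (Nat.size (w x) - (j + 1)), ← Nat.div_div_eq_div_mul]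
      generalize v x y / 2 ^ (Nat.size (w x) - (j + 1)) = z
      rw [pow_succ' 2 j, Nat.mod_mul]
      split_ifs <;> grind
  simpa using (key _ le_rfl).symm

theorem B.append_low {a t : Fn₂ m n} (ha : B F a) (ht : B F t) {w : Fn m} (hw : BNormal F w) :
    B F fun x y => a x y * 2 ^ Nat.size (w x) + t x y % 2 ^ Nat.size (w x) := by
  refine B.append_digits ha hw ?_
  have ht' : B F fun (x : Fin (m + 1) → ℕ) (y : Fin n → ℕ) => t (Fin.tail x) y :=
    ht.comp_normal (g := fun i x => x i.succ) (t := fun j _ y => y j) (fun i => .proj i.succ)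
      fun j => B.projSafe j
  have := B.cases_mod (ht'.shiftRight (BNormal.proj 0) 1) 1 fun c => B.const c
  simpa using this

/-! ### Simultaneous recursion on values of bounded length -/

/-- A tuple of numbers as one number, every entry in a field of `s` bits (higher bits are lost). -/
def packFields (s : ℕ) : ∀ {N : ℕ}, (Fin N → ℕ) → ℕ
  | 0, _ => 0
  | _ + 1, y => packFields s (Fin.tail y) * 2 ^ s + y 0 % 2 ^ s

theorem packFields_div_mod (s : ℕ) {N : ℕ} (y : Fin N → ℕ) (i : Fin N) :
    packFields s y / 2 ^ ((i : ℕ) * s) % 2 ^ s = y i % 2 ^ s := by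
  induction N with
  | zero => exact i.elim0
  | succ N ih =>
    refine Fin.cases ?_ (fun i => ?_) i
    · simp [packFields, Nat.add_mod]
    · have e : ((i.succ : Fin (N + 1)) : ℕ) * s = s + i * s := by simp; ring
      rw [e, pow_add, ← Nat.div_div_eq_div_mul, packFields, mul_comm,
        Nat.mul_add_div (by positivity), Nat.div_eq_of_lt (Nat.mod_lt _ (by positivity)), add_zero, ih]
      rfl

theorem B.pack {N : ℕ} {t : Fin N → Fn₂ m n} (ht : ∀ j, B F (t j)) {w : Fn m}
    (hw : BNormal F w) : B F fun x y => packFields (Nat.size (w x)) fun j => t j x y := by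
  induction N with
  | zero => exact B.const 0
  | succ N ih => exact B.append_low (ih fun j => ht j.succ) (ht 0) hw

theorem B.unpack {t : Fn₂ m n} (ht : B F t) {w : Fn m} (hw : BNormal F w) (i : ℕ) :
    B F fun x y => t x y / 2 ^ (i * Nat.size (w x)) % 2 ^ Nat.size (w x) := by
  simpa using B.append_low (B.const 0) (ht.shiftRight hw i) hw

/-- Simultaneous iteration: an iterated map of tuples whose components are functions of safe
arguments belongs to the algebra as long as all values have length at most `|w|`. -/
theorem BNormal.iterate {N : ℕ} {S : (Fin N → ℕ) → Fin N → ℕ}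
    (hS : ∀ i, B F fun (_ : Fin 0 → ℕ) y => S y i) {w t : Fn m} {a : (Fin m → ℕ) → Fin N → ℕ}
    (hw : BNormal F w) (ht : BNormal F t) (ha : ∀ i, BNormal F fun x => a x i)
    (hbound : ∀ x, ∀ k ≤ Nat.size (t x), ∀ i, S^[k] (a x) i < 2 ^ Nat.size (w x)) (i : Fin N) :
    BNormal F fun x => S^[Nat.size (t x)] (a x) i := by
  -- the tuple is unpacked, mapped by `S` and packed again in every round
  let H : ℕ → (Fin m → ℕ) → (Fin 0 → ℕ) → ℕ → ℕ := fun _ x _ r => packFields (Nat.size (w x))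
    (S fun j => r / 2 ^ ((j : ℕ) * Nat.size (w x)) % 2 ^ Nat.size (w x))
  have hH : B F fun (x : Fin (m + 1) → ℕ) (y : Fin (0 + 1) → ℕ) =>
      H (Nat.size (x 0)) (Fin.tail x) (Fin.init y) (y (Fin.last 0)) :=
    B.pack (fun j => B.comp_safe (hS j) fun i => B.unpack (B.projSafe _) hw.weaken i) hw.weaken
  have := B.unpack (B.lenRec (H := H) ht (B.pack ha hw) hH) hw i
  unfold BNormal
  convert this using 3 with x y
  have key : ∀ k ≤ Nat.size (t x), Nat.rec (motive := fun _ => ℕ)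
      (packFields (Nat.size (w x)) (a x)) (fun j r => H j x y r) k =
      packFields (Nat.size (w x)) (S^[k] (a x)) := by
    intro k
    induction k with
    | zero => simp
    | succ k ih =>
      intro hk
      have e : (fun j : Fin N => S^[k] (a x) j % 2 ^ Nat.size (w x)) = S^[k] (a x) :=
        funext fun j => Nat.mod_eq_of_lt (hbound x k (by lia) j)
      simp only [ih (by lia), H, packFields_div_mod, e, Function.iterate_succ_apply']
  rw [key _ le_rfl, packFields_div_mod, Nat.mod_eq_of_lt (hbound x _ le_rfl i)]

/-! ### Clocks of polynomial length -/

/-- `LengthBound F g`: some function of normal arguments in the algebra has values of length at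
least `g`. -/
def LengthBound (F : ∀ m n, Set (Fn₂ m n)) (g : Fn m) : Prop :=
  ∃ c : Fn m, BNormal F c ∧ ∀ x, g x ≤ Nat.size (c x)

theorem LengthBound.const (c : ℕ) : LengthBound F fun (_ : Fin m → ℕ) => c :=
  ⟨fun _ => 2 ^ c, .const _, fun _ => by simp [Nat.size_pow]⟩

theorem LengthBound.size (i : Fin m) : LengthBound F fun x => Nat.size (x i) :=
  ⟨fun x => x i, .proj i, fun _ => le_rfl⟩

/-- Appending `k` digits `1` to `a` lengthens it by `k`. -/
theorem size_rec_double_add_one (a k : ℕ) :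
    Nat.size (Nat.rec (motive := fun _ => ℕ) a (fun _ r => 2 * r + 1) k) = Nat.size a + k := by
  induction k with
  | zero => simp
  | succ k ih => simp only [size_two_mul_add_one, ih]; ring

theorem LengthBound.add {g h : Fn m} (hg : LengthBound F g) (hh : LengthBound F h) :
    LengthBound F fun x => g x + h x := by
  obtain ⟨c, hc, hcg⟩ := hg
  obtain ⟨d, hd, hdh⟩ := hh
  refine ⟨_, B.lenRec (H := fun _ _ _ r => 2 * r + 1) hd hc
    (B.double_add_one (B.projSafe (Fin.last 0))), fun x => ?_⟩
  rw [size_rec_double_add_one]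
  exact add_le_add (hcg x) (hdh x)

theorem LengthBound.mul {g h : Fn m} (hg : LengthBound F g) (hh : LengthBound F h) :
    LengthBound F fun x => g x * h x := by
  obtain ⟨c, hc, hcg⟩ := hg
  obtain ⟨d, hd, hdh⟩ := hh
  -- `A a k` appends `k` digits; appending `|d|` digits `|c|` times gives length `|c| * |d|`
  let A : ℕ → ℕ → ℕ := fun a k => Nat.rec (motive := fun _ => ℕ) a (fun _ r => 2 * r + 1) k
  have hA : B F fun (x : Fin (m + 1) → ℕ) (y : Fin 1 → ℕ) =>
      A (y (Fin.last 0)) (Nat.size (d (Fin.tail x))) :=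
    B.lenRec (H := fun _ _ _ r => 2 * r + 1) hd.weaken (B.projSafe (Fin.last 0))
      (B.double_add_one (B.projSafe (Fin.last 1)))
  refine ⟨_, B.lenRec (H := fun _ x _ r => A r (Nat.size (d x))) hc (B.const 0) hA, fun x => ?_⟩
  have key : ∀ k, Nat.size (Nat.rec (motive := fun _ => ℕ) 0
      (fun _ r => A r (Nat.size (d x))) k) = k * Nat.size (d x) := by
    intro k
    induction k with
    | zero => simp
    | succ k ih => simp only [A, size_rec_double_add_one] at ih ⊢; rw [ih]; ring
  rw [key]
  exact Nat.mul_le_mul (hcg x) (hdh x)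

theorem LengthBound.sum {ι : Type*} (s : Finset ι) {g : ι → Fn m}
    (hg : ∀ i, LengthBound F (g i)) : LengthBound F fun x => ∑ i ∈ s, g i x := by
  classical
  induction s using Finset.induction_on with
  | empty => simpa using LengthBound.const 0
  | insert i s hi ih => simpa [Finset.sum_insert hi] using (hg i).add ih

theorem LengthBound.polynomial (p : Polynomial ℕ) {g : Fn m} (hg : LengthBound F g) :
    LengthBound F fun x => p.eval (g x) := by
  induction p using Polynomial.induction_on' with
  | add p q hp hq => simpa using hp.add hq
  | monomial e a =>
    have : LengthBound F fun x => g x ^ e := by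
      induction e with
      | zero => simpa using LengthBound.const 1
      | succ e ih => simpa [pow_succ] using ih.mul hg
    simpa using (LengthBound.const a).mul this

theorem LengthBound.mvPolynomial (p : MvPolynomial (Fin m) ℕ) :
    LengthBound F fun x => MvPolynomial.eval (lengths x) p := by
  induction p using MvPolynomial.induction_on with
  | C a => simpa using LengthBound.const a
  | add p q hp hq => simpa using hp.add hq
  | mul_X p i hp => simpa [lengths] using hp.mul (LengthBound.size i)

/-! ### Stacks and configurations as numbers -/

/-- A list as a number, the code `e a` of every entry in a block of `c` bits, with the head of the
list in the lowest block. -/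
def listNum {α : Type*} (c : ℕ) (e : α → ℕ) : List α → ℕ
  | [] => 0
  | a :: l => listNum c e l * 2 ^ c + e a

section listNum

variable {α : Type*} {c : ℕ} {e : α → ℕ}

theorem listNum_mod (he : ∀ a, e a < 2 ^ c) (l : List α) :
    listNum c e l % 2 ^ c = l.head?.elim 0 e := by
  cases l with
  | nil => simp [listNum]
  | cons a l => simp [listNum, Nat.add_mod, Nat.mod_eq_of_lt (he a)]

theorem listNum_div (he : ∀ a, e a < 2 ^ c) (l : List α) :
    listNum c e l / 2 ^ c = listNum c e l.tail := by
  cases l with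
  | nil => simp [listNum]
  | cons a l =>
    rw [listNum, mul_comm, Nat.mul_add_div (by positivity), Nat.div_eq_of_lt (he a)]
    simp

theorem listNum_div_mod (he : ∀ a, e a < 2 ^ c) (l : List α) (j : ℕ) :
    listNum c e l / 2 ^ (c * j) % 2 ^ c = (l[j]?).elim 0 e := by
  induction j generalizing l with
  | zero => simp [listNum_mod he, List.head?_eq_getElem?]
  | succ j ih =>
    rw [mul_add, mul_one, add_comm, pow_add, ← Nat.div_div_eq_div_mul, listNum_div he, ih]
    simp

theorem listNum_lt (he : ∀ a, e a < 2 ^ c) (l : List α) :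
    listNum c e l < 2 ^ (c * l.length) := by
  induction l with
  | nil => simp [listNum]
  | cons a l ih =>
    rw [listNum, List.length_cons, mul_add, mul_one, pow_add]
    have := he a
    nlinarith

theorem length_le_size_listNum (he : ∀ a, 0 < e a ∧ e a < 2 ^ c) (l : List α) :
    l.length ≤ Nat.size (listNum c e l) := by
  induction l with
  | nil => simp
  | cons a l ih =>
    have hc : c ≠ 0 := by
      rintro rfl
      have := he a
      simp at this
      lia
    have h2 : 2 ≤ 2 ^ c := Nat.le_self_pow hc 2
    have : 2 * listNum c e l + 1 ≤ listNum c e (a :: l) := by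
      rw [listNum]
      nlinarith [(he a).1]
    calc l.length + 1 ≤ Nat.size (listNum c e l) + 1 := by lia
      _ = Nat.size (2 * listNum c e l + 1) := (size_two_mul_add_one _).symm
      _ ≤ _ := Nat.size_le_size this

end listNum

/-- A finite set can be coded by positive numbers of bounded length. The code `0` is left free for
the head of an empty list. -/
theorem exists_code {α : Type*} {U : Set α} (hU : U.Finite) :
    ∃ (c : ℕ) (e : α → ℕ) (d : ℕ → Option α),
      (∀ a, 0 < e a ∧ e a < 2 ^ c) ∧ d 0 = none ∧ ∀ a ∈ U, d (e a) = some a := by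
  classical
  obtain ⟨N, ⟨E⟩⟩ := hU.exists_equiv_fin
  let e : α → ℕ := fun a => if h : a ∈ U then E ⟨a, h⟩ + 1 else 1
  refine ⟨N + 1, e, fun i => if h : ∃ a ∈ U, e a = i then some h.choose else none, ?_, ?_, ?_⟩
  · intro a
    have := Nat.lt_two_pow_self (n := N + 1)
    by_cases h : a ∈ U
    · simp only [e, h, dite_true]
      have := (E ⟨a, h⟩).2
      lia
    · simp only [e, h, dite_false]
      lia
  · refine dif_neg ?_
    rintro ⟨a, ha, h⟩
    simp [e, ha] at h
  · intro a ha
    have hex : ∃ b ∈ U, e b = e a := ⟨a, ha, rfl⟩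
    refine (dif_pos hex).trans ?_
    obtain ⟨hb, h⟩ := hex.choose_spec
    generalize hex.choose = b at hb h
    have : E ⟨b, hb⟩ = E ⟨a, ha⟩ := Fin.ext (by simpa [e, ha, hb] using h)
    simpa using E.injective this

/-- `BSafe F E R`: the function `R` of safe arguments, indexed by `ι` through `E`, belongs to
`B F`. -/
def BSafe {ι : Type*} {N : ℕ} (F : ∀ m n, Set (Fn₂ m n)) (E : ι ≃ Fin N) (R : (ι → ℕ) → ℕ) : Prop :=
  B F fun (_ : Fin 0 → ℕ) (y : Fin N → ℕ) => R fun i => y (E i)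

section BSafe

variable {ι : Type*} {N : ℕ} {E : ι ≃ Fin N}

theorem BSafe.proj (i : ι) : BSafe F E fun y => y i := B.projSafe (E i)

theorem BSafe.const (c : ℕ) : BSafe F E fun _ => c := B.const c

theorem BSafe.comp {R : (ι → ℕ) → ℕ} {Q : (ι → ℕ) → ι → ℕ} (hR : BSafe F E R)
    (hQ : ∀ i, BSafe F E fun y => Q y i) : BSafe F E fun y => R (Q y) := by
  have := B.comp_safe (m := 0) (n := N) (h := fun y => R fun i => y (E i))
    (t := fun j _ y => Q (fun i => y (E i)) (E.symm j)) hR fun j => hQ (E.symm j)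
  simpa [BSafe] using this

theorem BSafe.update [DecidableEq ι] {k : ι} {t : (ι → ℕ) → ℕ} (ht : BSafe F E t) (i : ι) :
    BSafe F E fun y => Function.update y k (t y) i := by
  by_cases h : i = k
  · subst h; simpa using ht
  · simpa [h] using BSafe.proj i

/-- `BNormal.iterate` for tuples with an arbitrary finite index type. -/
theorem BNormal.iterate_safe {R : (ι → ℕ) → ι → ℕ} (hR : ∀ i, BSafe F E fun y => R y i)
    {w t : Fn m} {a : (Fin m → ℕ) → ι → ℕ}
    (hw : BNormal F w) (ht : BNormal F t) (ha : ∀ i, BNormal F fun x => a x i)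
    (hbound : ∀ x, ∀ k ≤ Nat.size (t x), ∀ i, R^[k] (a x) i < 2 ^ Nat.size (w x)) (i : ι) :
    BNormal F fun x => R^[Nat.size (t x)] (a x) i := by
  let S : (Fin N → ℕ) → Fin N → ℕ := fun y j => R (fun i => y (E i)) (E.symm j)
  have hS : ∀ k b j, S^[k] (fun j => b (E.symm j)) j = R^[k] b (E.symm j) := by
    intro k
    induction k with
    | zero => simp
    | succ k ih =>
      intro b j
      rw [Function.iterate_succ_apply, Function.iterate_succ_apply, ← ih]
      simp [S]
  have := BNormal.iterate (S := S) (a := fun x j => a x (E.symm j)) (fun j => hR (E.symm j)) hw ht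
    (fun j => ha _) (fun x k hk j => by simpa only [hS] using hbound x k hk (E.symm j)) (E i)
  simpa only [hS, Equiv.symm_apply_apply] using this

end BSafe

/-! ### Simulation of stack machines -/

open Turing

section machine

variable {K : Type} {Γ : K → Type} {Λ σ : Type}

/-- The symbols, together with their stacks, that a statement can push. -/
def pushed : TM2.Stmt Γ Λ σ → Set (Σ k, Γ k)
  | .push k f q => Set.range (fun v => ⟨k, f v⟩) ∪ pushed q
  | .peek _ _ q => pushed q
  | .pop _ _ q => pushed q
  | .load _ q => pushed q
  | .branch _ q₁ q₂ => pushed q₁ ∪ pushed q₂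
  | .goto _ => ∅
  | .halt => ∅

theorem finite_pushed [Finite σ] (q : TM2.Stmt Γ Λ σ) : (pushed q).Finite := by
  induction q with
  | push k f q ih => exact (Set.finite_range _).union ih
  | branch f q₁ q₂ ih₁ ih₂ => exact ih₁.union ih₂
  | goto | halt => exact Set.finite_empty
  | _ => assumption

/-- All stack symbols belong to `U`. -/
def SymbolsIn (U : Set (Σ k, Γ k)) (S : ∀ k, List (Γ k)) : Prop :=
  ∀ k, ∀ a ∈ S k, (⟨k, a⟩ : Σ k, Γ k) ∈ U

variable {U : Set (Σ k, Γ k)}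

theorem decode_head {c : K → ℕ} {e : ∀ k, Γ k → ℕ} {d : ∀ k, ℕ → Option (Γ k)}
    (he : ∀ k a, e k a < 2 ^ c k) (hd₀ : ∀ k, d k 0 = none)
    (hd : ∀ k a, (⟨k, a⟩ : Σ k, Γ k) ∈ U → d k (e k a) = some a)
    {S : ∀ k, List (Γ k)} (hS : SymbolsIn U S) (k : K) :
    d k (listNum (c k) (e k) (S k) % 2 ^ c k) = (S k).head? := by
  rw [listNum_mod (he k)]
  cases h : S k with
  | nil => simp [hd₀]
  | cons a l => simpa using hd k a (hS k a (by simp [h]))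

variable [DecidableEq K]

theorem SymbolsIn.push {S : ∀ k, List (Γ k)} (hS : SymbolsIn U S) {k : K} {a : Γ k}
    (ha : ⟨k, a⟩ ∈ U) : SymbolsIn U (Function.update S k (a :: S k)) := by
  intro k' b hb
  by_cases h : k' = k
  · subst h
    rw [Function.update_self, List.mem_cons] at hb
    rcases hb with rfl | hb
    exacts [ha, hS _ _ hb]
  · rw [Function.update_of_ne h] at hb
    exact hS _ _ hb

theorem SymbolsIn.pop {S : ∀ k, List (Γ k)} (hS : SymbolsIn U S) (k : K) :
    SymbolsIn U (Function.update S k (S k).tail) := by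
  intro k' b hb
  by_cases h : k' = k
  · subst h
    rw [Function.update_self] at hb
    exact hS _ _ (List.mem_of_mem_tail hb)
  · rw [Function.update_of_ne h] at hb
    exact hS _ _ hb

theorem SymbolsIn.stepAux {q : TM2.Stmt Γ Λ σ} (hq : pushed q ⊆ U) (v : σ)
    {S : ∀ k, List (Γ k)} (hS : SymbolsIn U S) : SymbolsIn U (TM2.stepAux q v S).stk := by
  induction q generalizing v S with
  | push k f q ih =>
    rw [pushed, Set.union_subset_iff] at hq
    exact ih hq.2 _ (hS.push (hq.1 ⟨v, rfl⟩))
  | peek k f q ih => exact ih hq _ hS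
  | pop k f q ih => exact ih hq _ (hS.pop k)
  | load f q ih => exact ih hq _ hS
  | branch f q₁ q₂ ih₁ ih₂ =>
    rw [pushed, Set.union_subset_iff] at hq
    rw [TM2.stepAux]
    cases f v
    exacts [ih₂ hq.2 _ hS, ih₁ hq.1 _ hS]
  | goto | halt => exact hS

theorem exists_length_stepAux_le (q : TM2.Stmt Γ Λ σ) :
    ∃ D, ∀ v S k, ((TM2.stepAux q v S).stk k).length ≤ (S k).length + D := by
  induction q with
  | push k f q ih =>
    obtain ⟨D, hD⟩ := ih
    refine ⟨D + 1, fun v S k' => (hD _ _ _).trans ?_⟩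
    by_cases h : k' = k
    · subst h; simp; lia
    · simp only [Function.update_of_ne h]; lia
  | peek k f q ih | load f q ih =>
    obtain ⟨D, hD⟩ := ih
    exact ⟨D, fun v S k' => hD _ _ _⟩
  | pop k f q ih =>
    obtain ⟨D, hD⟩ := ih
    refine ⟨D, fun v S k' => (hD _ _ _).trans ?_⟩
    by_cases h : k' = k
    · subst h; simp
    · simp [h]
  | branch f q₁ q₂ ih₁ ih₂ =>
    obtain ⟨D₁, hD₁⟩ := ih₁
    obtain ⟨D₂, hD₂⟩ := ih₂
    refine ⟨D₁ + D₂, fun v S k => ?_⟩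
    rw [TM2.stepAux]
    have := hD₁ v S k
    have := hD₂ v S k
    cases f v <;> dsimp only [cond] <;> lia
  | goto | halt => exact ⟨0, fun v S k => le_rfl⟩

/-- One step of a machine, a halted machine remaining as it is. -/
def totalStep (M : Λ → TM2.Stmt Γ Λ σ) (C : TM2.Cfg Γ Λ σ) : TM2.Cfg Γ Λ σ :=
  (TM2.step M C).getD C

theorem SymbolsIn.totalStep {M : Λ → TM2.Stmt Γ Λ σ} (hM : ∀ l, pushed (M l) ⊆ U)
    {C : TM2.Cfg Γ Λ σ} (hC : SymbolsIn U C.stk) : SymbolsIn U (totalStep M C).stk := by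
  obtain ⟨_ | l, v, S⟩ := C
  exacts [hC, hC.stepAux (hM l) v]

theorem exists_length_totalStep_le [Fintype Λ] (M : Λ → TM2.Stmt Γ Λ σ) :
    ∃ D, ∀ C k, ((totalStep M C).stk k).length ≤ (C.stk k).length + D := by
  choose D hD using fun l => exists_length_stepAux_le (M l)
  refine ⟨∑ l, D l, fun C k => ?_⟩
  obtain ⟨_ | l, v, S⟩ := C
  · exact Nat.le_add_right _ _
  · exact (hD l v S k).trans
      (Nat.add_le_add_left (Finset.single_le_sum (fun _ _ => Nat.zero_le _) (Finset.mem_univ l)) _)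

theorem totalStep_iterate {M : Λ → TM2.Stmt Γ Λ σ} {s : ℕ} {C D : TM2.Cfg Γ Λ σ}
    (h : (flip bind (TM2.step M))^[s] (some C) = some D) (hD : D.l = none) {t : ℕ} (ht : s ≤ t) :
    (totalStep M)^[t] C = D := by
  have hs : (totalStep M)^[s] C = D := by
    induction s generalizing C with
    | zero => simpa using h
    | succ s ih =>
      rw [Function.iterate_succ_apply] at h ⊢
      change (flip bind (TM2.step M))^[s] (TM2.step M C) = some D at h
      cases hC : TM2.step M C with
      | none =>
        rw [hC, Function.iterate_fixed (show flip bind (TM2.step M) none = none from rfl)] at h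
        cases h
      | some C' =>
        rw [hC] at h
        simpa [totalStep, hC] using ih h (by lia)
  have hfix : totalStep M D = D := by
    obtain ⟨l, v, S⟩ := D
    obtain rfl : l = none := hD
    rfl
  obtain ⟨r, rfl⟩ := Nat.exists_eq_add_of_le ht
  rw [add_comm, Function.iterate_add_apply, hs, Function.iterate_fixed hfix]

variable (c : K → ℕ) (e : ∀ k, Γ k → ℕ) (g : Option Λ × σ → ℕ)

/-- A configuration as a tuple of numbers: the code of its control state (component `none`) and
its stacks. -/
def cfgNum (C : TM2.Cfg Γ Λ σ) : Option K → ℕ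
  | none => g (C.l, C.var)
  | some k => listNum (c k) (e k) (C.stk k)

theorem cfgNum_update (l : Option Λ) (v : σ) (S : ∀ k, List (Γ k)) (k : K) (L : List (Γ k)) :
    cfgNum c e g ⟨l, v, Function.update S k L⟩ =
      Function.update (cfgNum c e g ⟨l, v, S⟩) (some k) (listNum (c k) (e k) L) := by
  ext (_ | k')
  · simp [cfgNum]
  · by_cases h : k' = k
    · subst h; simp [cfgNum]
    · simp [cfgNum, h]

variable {c e g}
variable {N : ℕ} {E : Option K ≃ Fin N} {d : ∀ k, ℕ → Option (Γ k)}

/-- The effect of a statement on the numbers of a configuration, for a fixed value of the internal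
state, is given by functions of safe arguments. -/
theorem exists_stepAux_num (he : ∀ k a, e k a < 2 ^ c k) (hd₀ : ∀ k, d k 0 = none)
    (hd : ∀ k a, (⟨k, a⟩ : Σ k, Γ k) ∈ U → d k (e k a) = some a)
    {q : TM2.Stmt Γ Λ σ} (hq : pushed q ⊆ U) (v : σ) :
    ∃ R : (Option K → ℕ) → Option K → ℕ, (∀ i, BSafe F E fun y => R y i) ∧
      ∀ l v₀ S, SymbolsIn U S →
        R (cfgNum c e g ⟨l, v₀, S⟩) = cfgNum c e g (TM2.stepAux q v S) := by
  induction q generalizing v with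
  | push k f q ih =>
    rw [pushed, Set.union_subset_iff] at hq
    obtain ⟨R, hR, hRS⟩ := ih hq.2 v
    refine ⟨fun y => R (Function.update y (some k) (y (some k) * 2 ^ c k + e k (f v))),
      fun i => (hR i).comp fun j => 
      BSafe.update (t := fun y => y (some k) * 2 ^ c k + e k (f v))
        (B.mul_two_pow_add (BSafe.proj (some k)) _ (he _ _)) j,
      fun l v₀ S hS => ?_⟩
    rw [TM2.stepAux, ← hRS l v₀ _ (hS.push (hq.1 ⟨v, rfl⟩)), cfgNum_update]
    rfl
  | peek k f q ih =>
    choose R hR hRS using fun v => ih hq v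
    refine ⟨fun y => R (f v (d k (y (some k) % 2 ^ c k))) y,
      fun i => B.cases_mod (BSafe.proj (some k)) (c k)
        (G := fun s _ y => R (f v (d k s)) (fun i => y (E i)) i) fun s => hR _ i,
      fun l v₀ S hS => ?_⟩
    rw [TM2.stepAux, ← hRS _ l v₀ S hS, ← decode_head he hd₀ hd hS]
    rfl
  | pop k f q ih =>
    choose R hR hRS using fun v => ih hq v
    refine ⟨fun y => R (f v (d k (y (some k) % 2 ^ c k)))
        (Function.update y (some k) (y (some k) / 2 ^ c k)),
      fun i => B.cases_mod (BSafe.proj (some k)) (c k)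
        (G := fun s _ y => R (f v (d k s)) (Function.update (fun i => y (E i)) (some k)
          (y (E (some k)) / 2 ^ c k)) i) fun s => (hR _ i).comp fun j =>
            BSafe.update (t := fun y => y (some k) / 2 ^ c k)
              (B.div_two_pow (BSafe.proj (some k)) _) j,
      fun l v₀ S hS => ?_⟩
    rw [TM2.stepAux, ← hRS _ l v₀ _ (hS.pop k), cfgNum_update, ← listNum_div (he k),
      ← decode_head he hd₀ hd hS]
    rfl
  | load f q ih =>
    obtain ⟨R, hR, hRS⟩ := ih hq (f v)
    exact ⟨R, hR, hRS⟩
  | branch f q₁ q₂ ih₁ ih₂ =>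
    rw [pushed, Set.union_subset_iff] at hq
    simp only [TM2.stepAux]
    cases f v
    exacts [ih₂ hq.2 v, ih₁ hq.1 v]
  | goto f =>
    refine ⟨fun y => Function.update y none (g (some (f v), v)),
      fun i => BSafe.update (BSafe.const _) i, fun l v₀ S hS => ?_⟩
    ext (_ | k) <;> simp [cfgNum]
  | halt =>
    refine ⟨fun y => Function.update y none (g (none, v)),
      fun i => BSafe.update (BSafe.const _) i, fun l v₀ S hS => ?_⟩
    ext (_ | k) <;> simp [cfgNum]

/-- One step of a machine acts on the numbers of a configuration by functions of safe arguments: the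
control state has finitely many codes, so it can be decided by cases. -/
theorem exists_totalStep_num (he : ∀ k a, e k a < 2 ^ c k) (hd₀ : ∀ k, d k 0 = none)
    (hd : ∀ k a, (⟨k, a⟩ : Σ k, Γ k) ∈ U → d k (e k a) = some a)
    {b : ℕ} {dg : ℕ → Option (Option Λ × σ)} (hg : ∀ s, g s < 2 ^ b)
    (hdg : ∀ s, dg (g s) = some s) {M : Λ → TM2.Stmt Γ Λ σ} (hM : ∀ l, pushed (M l) ⊆ U) :
    ∃ R : (Option K → ℕ) → Option K → ℕ, (∀ i, BSafe F E fun y => R y i) ∧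
      ∀ C, SymbolsIn U C.stk → R (cfgNum c e g C) = cfgNum c e g (totalStep M C) := by
  choose R hR hRS using fun l v =>
    exists_stepAux_num (F := F) (g := g) (E := E) he hd₀ hd (hM l) v
  let G : Option (Option Λ × σ) → (Option K → ℕ) → Option K → ℕ
    | some (some l, v) => R l v
    | _ => id
  have hG : ∀ s i, BSafe F E fun y => G s y i := by
    rintro (_ | ⟨_ | l, v⟩) i
    exacts [BSafe.proj i, BSafe.proj i, hR l v i]
  refine ⟨fun y => G (dg (y none % 2 ^ b)) y, fun i => B.cases_mod (BSafe.proj none) b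
    (G := fun s _ y => G (dg s) (fun i => y (E i)) i) fun s => hG _ i, fun C hC => ?_⟩
  have : dg (cfgNum c e g C none % 2 ^ b) = some (C.l, C.var) := by
    rw [cfgNum, Nat.mod_eq_of_lt (hg _), hdg]
  dsimp only
  rw [this]
  obtain ⟨_ | l, v, S⟩ := C
  exacts [rfl, hRS l v _ v S hC]

end machine

/-- If the initial configurations of a machine belong to the algebra and the machine halts within a
number of steps that is bounded by the length of a function in the algebra, then the final content
of the stack `k`, as a number, belongs to the algebra. The codes of the symbols in the finite set
`V` can be decoded. -/
theorem exists_bNormal_stack {K : Type} [DecidableEq K] [Fintype K] {Γ : K → Type} {Λ σ : Type}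
    [Fintype Λ] [Fintype σ] (M : Λ → TM2.Stmt Γ Λ σ) {V : Set (Σ k, Γ k)} (hV : V.Finite)
    {init : (Fin m → ℕ) → TM2.Cfg Γ Λ σ} {l₀ : Option Λ} {v₀ : σ}
    (hl : ∀ x, (init x).l = l₀) (hv : ∀ x, (init x).var = v₀)
    (hinitV : ∀ x, SymbolsIn V (init x).stk)
    (hinit : ∀ k c (e : Γ k → ℕ), (∀ a, e a < 2 ^ c) →
      BNormal F fun x => listNum c e ((init x).stk k))
    {len t : Fn m} (hlen : LengthBound F len) (hinitlen : ∀ x k, ((init x).stk k).length ≤ len x)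
    (ht : LengthBound F t) {out : (Fin m → ℕ) → TM2.Cfg Γ Λ σ}
    (hout : ∀ x, ∀ s ≥ t x, (totalStep M)^[s] (init x) = out x) (k : K) :
    ∃ (c : ℕ) (e : Γ k → ℕ) (d : ℕ → Option (Γ k)), (∀ a, 0 < e a ∧ e a < 2 ^ c) ∧ d 0 = none ∧
      (∀ a, (⟨k, a⟩ : Σ k, Γ k) ∈ V → d (e a) = some a) ∧
      BNormal F fun x => listNum c e ((out x).stk k) := by
  -- only the input alphabet is required to be finite, but the pushed symbols are finitely many
  let U : Set (Σ k, Γ k) := V ∪ ⋃ l, pushed (M l)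
  have hU : U.Finite := hV.union (Set.finite_iUnion fun l => finite_pushed _)
  have hM : ∀ l, pushed (M l) ⊆ U := fun l =>
    (Set.subset_iUnion (fun l => pushed (M l)) l).trans Set.subset_union_right
  choose c e d he hd₀ hd using fun k =>
    exists_code (hU.preimage (sigma_mk_injective (i := k)).injOn)
  obtain ⟨b, g, dg, hg, -, hdg⟩ := exists_code (Set.finite_univ (α := Option Λ × σ))
  obtain ⟨R, hR, hRC⟩ := exists_totalStep_num (F := F) (E := Fintype.equivFin (Option K))
    (fun k a => (he k a).2) hd₀ hd (fun s => (hg s).2) (fun s => hdg s trivial) hM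
  obtain ⟨D, hD⟩ := exists_length_totalStep_le M
  have hsym : ∀ x s, SymbolsIn U ((totalStep M)^[s] (init x)).stk := by
    intro x s
    induction s with
    | zero => exact fun k a ha => Or.inl (hinitV x k a ha)
    | succ s ih => rw [Function.iterate_succ_apply']; exact ih.totalStep hM
  have hRs : ∀ x s, R^[s] (cfgNum c e g (init x)) = cfgNum c e g ((totalStep M)^[s] (init x)) := by
    intro x s
    induction s with
    | zero => rfl
    | succ s ih => rw [Function.iterate_succ_apply', ih, hRC _ (hsym x s),
        Function.iterate_succ_apply']
  have hlens : ∀ x s k, (((totalStep M)^[s] (init x)).stk k).length ≤ len x + D * s := by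
    intro x s k
    induction s with
    | zero => simpa using hinitlen x k
    | succ s ih =>
      rw [Function.iterate_succ_apply']
      have := hD ((totalStep M)^[s] (init x)) k
      rw [mul_add]; lia
  -- the clock `T` may overrun, as `totalStep` fixes halted configurations
  obtain ⟨T, hT, htT⟩ := ht
  obtain ⟨w, hw, hwle⟩ := ((LengthBound.const (∑ k, c k)).mul
    (hlen.add ((LengthBound.const D).mul ⟨T, hT, fun _ => le_rfl⟩))).add (LengthBound.const b)
  refine ⟨c k, e k, d k, he k, hd₀ k, fun a ha => hd k a (Or.inl ha), ?_⟩
  have := BNormal.iterate_safe hR (a := fun x => cfgNum c e g (init x)) hw hT ?_ ?_ (some k)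
  · simpa only [hRs, hout _ _ (htT _), cfgNum] using this
  · rintro (_ | k)
    · simpa only [cfgNum, hl, hv] using BNormal.const _
    · exact hinit k _ _ fun a => (he k a).2
  · intro x s hs i
    rw [hRs]
    rcases i with _ | k
    · exact (hg _).2.trans_le (Nat.pow_le_pow_right two_pos (le_trans (by lia) (hwle x)))
    · refine (listNum_lt (fun a => (he k a).2) _).trans_le
        (Nat.pow_le_pow_right two_pos (le_trans ?_ (hwle x)))
      refine le_add_right (Nat.mul_le_mul
        (Finset.single_le_sum (fun _ _ => Nat.zero_le _) (Finset.mem_univ k)) ?_)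
      exact (hlens x s k).trans (Nat.add_le_add_left (Nat.mul_le_mul_left _ hs) _)

/-! ### Encoding the input and decoding the output -/

open Computability

theorem encodeNat_eq_bits (a : ℕ) : encodeNat a = a.bits := by
  have hpos : ∀ p : PosNum, encodePosNum p = (p : ℕ).bits := by
    intro p
    induction p with
    | one => simp [encodePosNum]
    | bit0 p ih =>
      rw [encodePosNum, ih, PosNum.cast_bit0, ← two_mul, Nat.bit0_bits _ p.to_nat_pos.ne']
    | bit1 p ih =>
      rw [encodePosNum, ih, PosNum.cast_bit1, ← two_mul, Nat.bit1_bits]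
  have hnum : ∀ p : Num, encodeNum p = (p : ℕ).bits := by
    rintro (_ | p)
    exacts [by simp [encodeNum], hpos p]
  rw [encodeNat, hnum, Num.to_of_nat]

theorem div_two_pow_mod_two_eq_bits (a j : ℕ) :
    a / 2 ^ j % 2 = (a.bits[j]?).elim 0 Bool.toNat := by
  rw [← Nat.toNat_testBit, Nat.testBit_eq_inth, List.getI_eq_getElem?_getD]
  cases a.bits[j]? <;> rfl

theorem listNum_append {α : Type*} (c : ℕ) (e : α → ℕ) (l₁ l₂ : List α) :
    listNum c e (l₁ ++ l₂) = l₁.foldr (fun a s => s * 2 ^ c + e a) (listNum c e l₂) := by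
  induction l₁ with
  | nil => rfl
  | cons a l ih => simp [listNum, ih]

theorem listNum_map {α β : Type*} (c : ℕ) (e : β → ℕ) (φ : α → β) (l : List α) :
    listNum c e (l.map φ) = listNum c (fun a => e (φ a)) l := by
  induction l with
  | nil => rfl
  | cons a l ih => simp [listNum, ih]

theorem encodeTuple_succ {k : ℕ} (x : Fin (k + 1) → ℕ) :
    encodeTuple x = (x 0).bits.map some ++ none :: encodeTuple (Fin.tail x) := by
  simp [encodeTuple, encodeNat_eq_bits, List.ofFn_succ]
  rfl

theorem length_encodeTuple {k : ℕ} (x : Fin k → ℕ) :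
    (encodeTuple x).length = ∑ i, (Nat.size (x i) + 1) := by
  induction k with
  | zero => simp [encodeTuple]
  | succ k ih =>
    rw [encodeTuple_succ, Fin.sum_univ_succ]
    simp [ih, Nat.size_eq_bits_len, Fin.tail]
    ring

/-- The input word of a machine, as a stack: recursion on notation pushes the bits of one entry, in
the required order, on a safe argument that holds the word of the later entries. -/
theorem BNormal.listNum_encodeTuple {c : ℕ} {e : Option Bool → ℕ} (he : ∀ a, e a < 2 ^ c) {k : ℕ}
    {g : Fin k → Fn m} (hg : ∀ i, BNormal F (g i)) :
    BNormal F fun x => listNum c e (encodeTuple fun i => g i x) := by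
  induction k with
  | zero => exact BNormal.const 0
  | succ k ih =>
    have hbits : B F fun (u : Fin 1 → ℕ) (s : Fin 1 → ℕ) =>
        ((u 0).bits.map some).foldr (fun a s => s * 2 ^ c + e a) (s 0) := by
      refine B.srec (B.projSafe 0) ((B.projSafe (Fin.last 1)).mul_two_pow_add c (he (some false)))
        ((B.projSafe (Fin.last 1)).mul_two_pow_add c (he (some true))) ?_ ?_ ?_
      · simp
      · intro u x y hu
        simp [Nat.bit0_bits u hu, -Fin.reduceLast]
      · intro u x y
        simp [-Fin.reduceLast]
    have := hbits.comp_normal (g := fun _ => g 0) (t := fun _ x (_ : Fin 0 → ℕ) =>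
        listNum c e (encodeTuple fun i : Fin k => g i.succ x) * 2 ^ c + e none)
      (fun _ => hg 0) fun _ => (ih fun i => hg i.succ).mul_two_pow_add c (he none)
    unfold BNormal
    convert this using 3 with x y
    dsimp only
    rw [encodeTuple_succ, listNum_append, listNum]
    rfl

/-- A function belongs to the algebra as soon as the blockwise coded list of its bits does: that
number serves both as a normal argument to look the bits up in and as a bound on their number. -/
theorem BNormal.of_listNum_bits {f : Fn m} {α : Type*} {φ : Bool → α} {ψ : α → Bool}
    (hφ : ∀ b, ψ (φ b) = b) {c : ℕ} {e : α → ℕ} {d : ℕ → Option α}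
    (he : ∀ a, 0 < e a ∧ e a < 2 ^ c) (hd₀ : d 0 = none) (hd : ∀ a, d (e a) = some a)
    (h : BNormal F fun x => listNum c e ((f x).bits.map φ)) : BNormal F f := by
  have hdigit : BNormal F fun (x : Fin (m + 1) → ℕ) =>
      f (Fin.tail x) / 2 ^ Nat.size (x 0) % 2 := by
    have := B.cases_mod (B.shiftRight h.weaken (BNormal.proj 0) c) c
      (G := fun s _ _ => (d s).elim 0 fun a => (ψ a).toNat) fun s => B.const _
    unfold BNormal
    convert this using 3 with x y
    dsimp only
    rw [listNum_div_mod fun a => (he a).2, div_two_pow_mod_two_eq_bits, List.getElem?_map]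
    cases (f (Fin.tail x)).bits[Nat.size (x 0)]? <;> simp [hd₀, hd, hφ]
  have := B.append_digits (v := fun x _ => f x) (B.const 0) h hdigit
  unfold BNormal
  convert this using 3 with x y
  rw [zero_mul, zero_add, Nat.mod_eq_of_lt]
  rw [← Nat.size_le, ← Nat.size_eq_bits_len (f x)]
  simpa using length_le_size_listNum he ((f x).bits.map φ)

/-- One half of the Bellantoni–Cook theorem: polynomial time functions, with all arguments normal,
belong to the algebra. -/
theorem bNormal_of_mem_FP {f : Fn m} (hf : f ∈ FP m) : BNormal F f := by
  obtain ⟨⟨⟨tm, ia, oa⟩, time, hout⟩⟩ := hf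
  dsimp only at ia oa hout
  let := tm.kDecidableEq
  let := tm.kFin
  let := tm.ΛFin
  let := tm.σFin
  let inp : (Fin m → ℕ) → List (tm.Γ tm.k₀) := fun x => (encodeTuple x).map ia.invFun
  -- the input and output alphabets are the symbols whose codes have to be read back
  let V : Set (Σ k, tm.Γ k) := Set.range (Sigma.mk tm.k₀) ∪ Set.range (Sigma.mk tm.k₁)
  have : Finite (tm.Γ tm.k₀) := Finite.of_equiv _ ia.symm
  have : Finite (tm.Γ tm.k₁) := Finite.of_equiv _ oa.symm
  have hV : V.Finite := (Set.finite_range _).union (Set.finite_range _)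
  have hself : ∀ x, (initList tm (inp x)).stk tm.k₀ = inp x := fun x => dif_pos rfl
  have hne : ∀ x k, k ≠ tm.k₀ → (initList tm (inp x)).stk k = [] := fun x k hk => dif_neg hk
  have hlen : LengthBound F fun x : Fin m → ℕ => (encodeTuple x).length := by
    simp only [length_encodeTuple]
    exact LengthBound.sum _ fun i => (LengthBound.size i).add (LengthBound.const 1)
  have hinpV : ∀ x, SymbolsIn V (initList tm (inp x)).stk := by
    intro x k a ha
    by_cases hk : k = tm.k₀
    · subst hk
      exact Or.inl ⟨a, rfl⟩
    · simp [hne x k hk] at ha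
  have hinp : ∀ k c (e : tm.Γ k → ℕ), (∀ a, e a < 2 ^ c) →
      BNormal F fun x => listNum c e ((initList tm (inp x)).stk k) := by
    intro k c e he
    by_cases hk : k = tm.k₀
    · subst hk
      simp only [hself, inp, listNum_map]
      exact BNormal.listNum_encodeTuple (fun a => he _) fun i => .proj i
    · simp only [hne _ k hk]
      exact BNormal.const 0
  have hinplen : ∀ x k, ((initList tm (inp x)).stk k).length ≤ (encodeTuple x).length := by
    intro x k
    by_cases hk : k = tm.k₀
    · subst hk
      rw [hself]
      simp [inp]
    · simp [hne x k hk]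
  obtain ⟨c, e, d, he, hd₀, hd, h⟩ := exists_bNormal_stack tm.m hV
    (fun _ => rfl) (fun _ => rfl) hinpV hinp hlen hinplen (hlen.polynomial time)
    (init := fun x => initList tm (inp x))
    (out := fun x => haltList tm ((encodeNat (f x)).map oa.invFun))
    (fun x s hs => totalStep_iterate (hout x).evals_in_steps rfl ((hout x).steps_le_m.trans hs))
    tm.k₁
  have hk₁ : ∀ l, (haltList tm l).stk tm.k₁ = l := fun l => dif_pos rfl
  simp only [hk₁, encodeNat_eq_bits] at h
  exact BNormal.of_listNum_bits (ψ := oa) (fun b => oa.apply_symm_apply b) he hd₀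
    (fun a => hd a (Or.inr ⟨a, rfl⟩)) h

/-! ### Advice from oracles -/

theorem bNormal_of_mem_RR {r : Fn m} (hr : r ∈ RR m) : BNormal (nor RR) r :=
  B.oracle ⟨rfl, r, hr, fun _ _ => rfl⟩

/-- Polynomially bounded advice is read off, bit by bit, from two oracles with an additional
argument whose length is a position: one tells whether the position lies within the advice word,
the other is the bit there. -/
theorem bNormal_wordNat_advice {α : (Fin m → ℕ) → List Bool} {p : MvPolynomial (Fin m) ℕ}
    (hα : ∀ n, (α n).length ≤ MvPolynomial.eval n p) :
    BNormal (nor RR) fun x => wordNat (α (lengths x)) := by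
  have hlen : ∀ x y : Fin (m + 1) → ℕ, lengths x = lengths y →
      Nat.size (x 0) = Nat.size (y 0) ∧ lengths (Fin.tail x) = lengths (Fin.tail y) :=
    fun x y h => ⟨congrFun h 0, funext fun i => congrFun h i.succ⟩
  have hin : BNormal (nor RR) fun (x : Fin (m + 1) → ℕ) =>
      if Nat.size (x 0) < (α (lengths (Fin.tail x))).length then 0 else 1 := by
    refine bNormal_of_mem_RR ⟨fun x => ?_, fun x y h => ?_⟩
    · dsimp only
      split_ifs <;> simp
    · simp only [hlen x y h]
  have hbit : BNormal (nor RR) fun (x : Fin (m + 1) → ℕ) =>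
      ((α (lengths (Fin.tail x))).getD (Nat.size (x 0)) false).toNat := by
    refine bNormal_of_mem_RR ⟨fun x => ?_, fun x y h => ?_⟩
    · cases (α (lengths (Fin.tail x))).getD (Nat.size (x 0)) false <;> simp
    · simp only [hlen x y h]
  obtain ⟨w, hw, hpw⟩ := LengthBound.mvPolynomial (F := nor RR) p
  let H : ℕ → (Fin m → ℕ) → (Fin 0 → ℕ) → ℕ → ℕ := fun j x _ r =>
    if (if j < (α (lengths x)).length then 0 else 1) % 2 = 0 then
      if ((α (lengths x)).getD j false).toNat % 2 = 0 then 2 * r else 2 * r + 1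
    else r
  have hr : B (nor RR) fun (_ : Fin (m + 1) → ℕ) (y : Fin (0 + 1) → ℕ) => y (Fin.last 0) :=
    B.projSafe _
  have := B.lenRec (H := H) hw (B.const 1)
    (hin.toB.ite_even (hbit.toB.ite_even hr.double hr.double_add_one) hr)
  unfold BNormal
  convert this using 3 with x y
  have key : ∀ j, Nat.rec (motive := fun _ => ℕ) 1 (fun j r => H j x y r) j =
      wordNat ((α (lengths x)).take j) := by
    intro j
    induction j with
    | zero => rfl
    | succ j ih =>
      simp only [ih, H, List.take_add_one]
      by_cases hj : j < (α (lengths x)).length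
      · cases hb : (α (lengths x))[j] <;> simp [hj, hb, wordNat, Nat.bit_val]
      · simp [hj]
  rw [key, List.take_of_length_le ((hα _).trans (hpw x))]

end NonUniform

theorem mainTheorem4 (k : ℕ) (f : NonUniform.Fn k) (hf : f ∈ NonUniform.FPpoly k) :
    NonUniform.B (NonUniform.nor NonUniform.RR) (fun (x : Fin k → ℕ) (_ : Fin 0 → ℕ) => f x) := by
  obtain ⟨α, p, f', hα, hf', hf⟩ := hf
  simp only [hf]
  -- the advice depends on normal arguments only, so it may fill a normal argument of `f'`
  exact (NonUniform.bNormal_of_mem_FP hf').cons (NonUniform.bNormal_wordNat_advice hα)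
    fun i => .proj i
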